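/- Let $\zeta(\sigma,a)$, $\Re(a)>0$, be the Hurwitz zeta function, i.e. the analytic continuation to $\sigma\in\mathbb C\setminus\{1\}$ of $\sum_{k\ge 0}(k+a)^{-\sigma}$ ($\Re\sigma>1$, principal powers). Write $\zeta^{(r,0)}(j,a)$ for its $r$-th derivative in $\sigma$ at $\sigma=j$, and define the generalized Stieltjes constants $\gamma_\ell(a)$ by $$\zeta(\sigma,a)=\frac1{\sigma-1}+\sum_{\ell\ge0}\frac{(-1)^\ell}{\ell!}\gamma_\ell(a)(\sigma-1)^\ell$$ near $\sigma=1$. Let $s(n,k)$ be the signed Stirling numbers of the first kind, $x(x+1)\cdots(x+n-1)=\sum_{k=0}^n(-1)^{n-k}s(n,k)x^k$, let $\ln$ be the principal logarithm, and put $$c_j=\sum_{k=0}^{\ell}s(j,k+1)\frac{\ell!}{(\ell-k)!}(-1)^k\zeta^{(\ell-k,0)}(j,a)\qquad(j\ge2).$$ Let $\ell\ge0$ be an integer and let $a\in\mathbb C$ with $\Re(a)\ge1$. (1) If $a\ne1$, then the series over $j$ below converge and $$(-1)^\ell\gamma_\ell(a)=\sum_{j=2}^\infty\frac{(-1)^j}{j!}c_j+\sum_{k=0}^\ell\frac{\ell!}{(\ell-k)!}\ln^{\ell-k}(a)\sum_{j=1}^\infty\frac{(-1)^{j+\ell+1}a^{-j}}{j!}s(j,k+1)+(-1)^{\ell+1}\frac{\ln^{\ell+1}a}{\ell+1},$$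 and moreover $$(-1)^\ell\gamma_\ell(a)=-(-1)^\ell\frac{\ln^{\ell+1}(a-1)}{\ell+1}+\sum_{j=2}^\infty\frac{(-1)^j}{j!}c_j .$$ (2) The series below converges (possibly only conditionally) and $$(-1)^\ell\gamma_\ell(a)=-(-1)^\ell\frac{\ln^{\ell+1}a}{\ell+1}-\sum_{j=2}^\infty\frac{1}{j!}c_j .$$ -/

import Mathlib

open Filter Topology Finset

open scoped Nat

noncomputable section

namespace GenStieltjes

/-- `F` is holomorphic on the half-plane `Re s > r` with the point `1` removed, and it is given
by the Hurwitz series `∑_{k ≥ 0} (k + a)^(-s)` (principal powers) for `Re s > 1`. -/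
def IsHurwitzContinuation (a : ℂ) (r : ℝ) (F : ℂ → ℂ) : Prop :=
  DifferentiableOn ℂ F ({s : ℂ | r < s.re} \ {1}) ∧
    ∀ s : ℂ, 1 < s.re → F s = ∑' k : ℕ, 1 / ((k : ℂ) + a) ^ s

open Classical in
/-- The Hurwitz zeta function `ζ(σ, a)`, `Re a > 0`, as a function on `ℂ \ {1}`: the value at `σ`
of the analytic continuation of the Hurwitz series to a punctured half-plane containing `σ`
(by the identity theorem the value does not depend on the half-plane).
The value at the pole `σ = 1` is set to `0`. -/
def hurwitz (σ a : ℂ) : ℂ :=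
  if h : σ ≠ 1 ∧ ∃ F : ℂ → ℂ, ∃ r : ℝ, r < σ.re ∧ IsHurwitzContinuation a r F then
    h.2.choose σ
  else 0

/-- `ζ^{(r,0)}(s, a)`: the `r`-th derivative of `σ ↦ ζ(σ, a)`, computed at `σ = s`. -/
def hurwitzDeriv (r : ℕ) (s a : ℂ) : ℂ :=
  iteratedDeriv r (fun σ : ℂ => hurwitz σ a) s

/-- The regular part `σ ↦ ζ(σ, a) - 1 / (σ - 1)` at the pole `σ = 1`, the value at `σ = 1` being
its limit there. -/
def hurwitzRegular (a : ℂ) : ℂ → ℂ :=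
  Function.update (fun σ : ℂ => hurwitz σ a - 1 / (σ - 1)) 1
    (limUnder (𝓝[≠] (1 : ℂ)) (fun σ : ℂ => hurwitz σ a - 1 / (σ - 1)))

/-- The generalized Stieltjes constants `γ_ℓ(a)`, the coefficients in
`ζ(σ, a) = 1 / (σ - 1) + ∑_{ℓ ≥ 0} (-1)^ℓ / ℓ! * γ_ℓ(a) * (σ - 1)^ℓ`. -/
def stieltjes (ℓ : ℕ) (a : ℂ) : ℂ :=
  (-1) ^ ℓ * iteratedDeriv ℓ (hurwitzRegular a) 1

/-- The signed Stirling numbers of the first kind,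
`x (x + 1) ⋯ (x + n - 1) = ∑_k (-1)^(n - k) s(n, k) x^k`. -/
def stirling (n k : ℕ) : ℂ :=
  (-1) ^ (n + k) * (Nat.stirlingFirst n k : ℂ)

/-- `∑_{k=0}^ℓ s(j, k+1) (ℓ! / (ℓ - k)!) (-1)^k ζ^{(ℓ-k,0)}(j, a)`. -/
def coeffZ (ℓ : ℕ) (a : ℂ) (j : ℕ) : ℂ :=
  ∑ k ∈ range (ℓ + 1), stirling j (k + 1) * ((ℓ ! : ℂ) / ((ℓ - k)! : ℂ)) * (-1) ^ k *
    hurwitzDeriv (ℓ - k) (j : ℂ) a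

end GenStieltjes

end

namespace GenStieltjes

/-! Put L(x) = log^(ℓ+1) x / (ℓ+1). Its j-th derivative is x^(-j) times a polynomial in log x with
Stirling coefficients (`iteratedDeriv_logPow`), so c_j = (-1)^ℓ ∑_n L^(j)(a+n) for j ≥ 2
(`hasSum_coeffZ`). For e = ±1, multiplying by e^j/j! and exchanging the sums turns ∑_{j≥2} into
(-1)^ℓ ∑_n R_e(a+n), with R_e(x) = L(x+e) - L(x) - e L'(x) the Taylor tail (`tendsto_coeffZ`). For e
= 1 this is the series for γ_ℓ(a) obtained by differentiating a continuation of (s-1)ζ(s,a) at s = 1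
(`hasSum_stieltjes`, `stieltjes_eq`), which is (2). Since R_1 + R_{-1} is a second difference of L,
the two sums add up to L(a-1) - L(a) (`logPowTail_sum_add_sum`), giving the second formula of (1).
The first follows by expanding L(a-1) in its Taylor series at a (`sum_mul_eq_logPow_sub`). The
exchange is absolute when Re a ≥ 2; otherwise the term n = 0 is split off. Its Taylor series
converges because |a| > 1, except at a = 1, e = 1, where Abel's theorem and the decay of Stirling
numbers over j! are needed (`tendsto_logPowCoeff_at_one`). -/

/-! ### Termwise differentiation and bounds for complex powers -/

theorem tendstoLocallyUniformlyOn_iterate_deriv {ι : Type*} {p : Filter ι} [p.NeBot]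
    {F : ι → ℂ → ℂ} {f : ℂ → ℂ} {U : Set ℂ} (hf : TendstoLocallyUniformlyOn F f p U)
    (hF : ∀ i, DifferentiableOn ℂ (F i) U) (hU : IsOpen U) (r : ℕ) :
    TendstoLocallyUniformlyOn (fun i => deriv^[r] (F i)) (deriv^[r] f) p U ∧
      ∀ i, DifferentiableOn ℂ (deriv^[r] (F i)) U := by
  induction r with
  | zero => exact ⟨hf, hF⟩
  | succ r ih =>
    simp only [Function.iterate_succ_apply']
    exact ⟨ih.1.deriv (Eventually.of_forall ih.2) hU, fun i => (ih.2 i).deriv hU⟩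

theorem hasSum_iteratedDeriv {F : ℕ → ℂ → ℂ} {u : ℕ → ℝ} {U : Set ℂ} (hu : Summable u)
    (hf : ∀ i, DifferentiableOn ℂ (F i) U) (hU : IsOpen U)
    (hF_le : ∀ i, ∀ w ∈ U, ‖F i w‖ ≤ u i) {z : ℂ} (hz : z ∈ U) (r : ℕ) :
    HasSum (fun i => iteratedDeriv r (F i) z) (iteratedDeriv r (fun w => ∑' i, F i w) z) := by
  rw [HasSum]
  have hc := (tendstoUniformlyOn_tsum hu hF_le).tendstoLocallyUniformlyOn
  have h := ((tendstoLocallyUniformlyOn_iterate_deriv hc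
    (fun s => DifferentiableOn.fun_sum fun i _ => hf i) hU r).1).tendsto_at hz
  simp only [← iteratedDeriv_eq_iterate] at h
  simp only [SummationFilter.unconditional_filter] at h ⊢
  refine h.congr fun s => ?_
  exact iteratedDeriv_fun_sum fun i _ => ((hf i).contDiffOn hU).contDiffAt (hU.mem_nhds hz)

theorem norm_cpow_neg_le {x s : ℂ} (hx : 1 ≤ x.re) (hs : 0 ≤ s.re) :
    ‖x ^ (-s)‖ ≤ Real.exp (Real.pi * |s.im|) * x.re ^ (-s.re) := by
  have hx0 : x ≠ 0 := by rintro rfl; norm_num at hx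
  rw [Complex.norm_cpow_of_ne_zero hx0, div_eq_mul_inv, ← Real.exp_neg, mul_comm]
  gcongr ?_ * ?_
  · rw [Real.exp_le_exp]
    calc -(x.arg * (-s).im) ≤ |x.arg * s.im| := by
          simpa using le_abs_self (x.arg * s.im)
      _ ≤ Real.pi * |s.im| := by
        rw [abs_mul]; gcongr; exact Complex.abs_arg_le_pi x
  · exact Real.rpow_le_rpow_of_nonpos (by linarith) (Complex.re_le_norm x) (by simpa using hs)

theorem hasDerivAt_cpow_base {x s : ℂ} (hx : 0 < x.re) :
    HasDerivAt (fun y : ℂ => y ^ s) (s * x ^ (s - 1)) x := by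
  simpa using (hasDerivAt_id x).cpow_const (c := s) (Or.inl hx)

theorem norm_cpow_sub_cpow_le {x y s : ℂ} (hx : 1 ≤ x.re) (hy : x.re ≤ y.re) (hs : 0 ≤ s.re) :
    ‖y ^ (-s) - x ^ (-s)‖ ≤
      ‖s‖ * (Real.exp (Real.pi * |s.im|) * x.re ^ (-(s.re + 1))) * ‖y - x‖ := by
  refine Convex.norm_image_sub_le_of_norm_hasDerivWithin_le (𝕜 := ℂ) (s := {z : ℂ | x.re ≤ z.re})
    (f := fun z : ℂ => z ^ (-s)) (f' := fun z => -s * z ^ (-s - 1))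
    (fun z hz => (hasDerivAt_cpow_base ?_).hasDerivWithinAt) (fun z hz => ?_)
    (convex_halfSpace_re_ge _) (by simp) hy
  · have : x.re ≤ z.re := hz
    linarith
  · have hz' : x.re ≤ z.re := hz
    rw [norm_mul, norm_neg]
    gcongr
    have h := norm_cpow_neg_le (x := z) (s := s + 1) (hx.trans hz') (by simp; linarith)
    rw [neg_add'] at h
    refine h.trans ?_
    simp only [Complex.add_im, Complex.one_im, add_zero, Complex.add_re, Complex.one_re]
    gcongr ?_ * ?_
    exact Real.rpow_le_rpow_of_nonpos (by linarith) hz' (by linarith)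

/-- The function z^(1-s) + (s-1)x^(-s)z has derivative -(s-1)(z^(-s) - x^(-s)), itself small by the
mean value inequality. The resulting exponent Re s + 1 is what carries the step series past the line
Re s = 1. -/
theorem norm_cpow_step_le {x s : ℂ} (hx : 1 ≤ x.re) (hs : 0 ≤ s.re) :
    ‖(s - 1) * x ^ (-s) - x ^ (1 - s) + (x + 1) ^ (1 - s)‖ ≤
      ‖s - 1‖ * (‖s‖ * (Real.exp (Real.pi * |s.im|) * x.re ^ (-(s.re + 1)))) := by
  have key := Convex.norm_image_sub_le_of_norm_hasDerivWithin_le (𝕜 := ℂ) (s := segment ℝ x (x + 1))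
    (f := fun z : ℂ => z ^ (1 - s) + (s - 1) * x ^ (-s) * z)
    (f' := fun z => (1 - s) * z ^ (1 - s - 1) + (s - 1) * x ^ (-s) * 1) (x := x) (y := x + 1)
    (C := ‖s - 1‖ * (‖s‖ * (Real.exp (Real.pi * |s.im|) * x.re ^ (-(s.re + 1)))))
    (fun z hz => ?_) (fun z hz => ?_)
    (convex_segment _ _) (left_mem_segment ℝ _ _) (right_mem_segment ℝ _ _)
  · simp only [add_sub_cancel_left, norm_one, mul_one] at key
    convert! key using 2
    ring
  · obtain ⟨θ, hθ, rfl⟩ := (segment_eq_image' ℝ x (x + 1)) ▸ hz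
    refine ((hasDerivAt_cpow_base ?_).add ((hasDerivAt_id _).const_mul _)).hasDerivWithinAt
    simp
    linarith [hθ.1]
  · obtain ⟨θ, hθ, rfl⟩ := (segment_eq_image' ℝ x (x + 1)) ▸ hz
    set z := x + θ • (x + 1 - x) with hzdef
    have hzre : z.re = x.re + θ := by simp [hzdef]
    have hzx : ‖z - x‖ ≤ 1 := by
      simp only [hzdef, add_sub_cancel_left, norm_smul, Real.norm_eq_abs, norm_one, mul_one]
      rw [abs_of_nonneg hθ.1]; exact hθ.2
    have e : (1 - s) * z ^ (1 - s - 1) + (s - 1) * x ^ (-s) * 1 =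
        -(s - 1) * (z ^ (-s) - x ^ (-s)) := by
      rw [show 1 - s - 1 = -s by ring]; ring
    rw [e, norm_mul, norm_neg]
    gcongr
    refine (norm_cpow_sub_cpow_le hx (by linarith [hθ.1]) hs).trans ?_
    exact mul_le_of_le_one_right (by positivity) hzx

/-! ### Continuation of (s-1)ζ(s,a) to Re s > 1/2 -/

/-- The bounded part of the half-plane `p < Re s`. -/
def boundedHalfPlane (p R : ℝ) : Set ℂ := {s | p < s.re} ∩ Metric.ball 0 R

theorem isOpen_boundedHalfPlane (p R : ℝ) : IsOpen (boundedHalfPlane p R) :=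
  (isOpen_lt continuous_const Complex.continuous_re).inter Metric.isOpen_ball

theorem mem_boundedHalfPlane {p : ℝ} {s : ℂ} (hs : p < s.re) :
    s ∈ boundedHalfPlane p (‖s‖ + 1) := ⟨hs, by simp⟩

/-- `(s - 1) x^(-s) - x^(1 - s) + (x + 1)^(1 - s)` at `x = a + n`. -/
noncomputable def stepTerm (a : ℂ) (n : ℕ) (s : ℂ) : ℂ :=
  (s - 1) * (a + n) ^ (-s) - (a + n) ^ (1 - s) + (a + n + 1) ^ (1 - s)

/-- The function `(s - 1) ζ(s, a)` on the half-plane `1 / 2 < Re s`. -/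
noncomputable def poleFree (a s : ℂ) : ℂ := a ^ (1 - s) + ∑' n, stepTerm a n s

theorem summable_add_one_rpow {p : ℝ} (hp : 1 < p) :
    Summable fun n : ℕ => ((n : ℝ) + 1) ^ (-p) := by
  have := (summable_nat_add_iff 1).2 (Real.summable_nat_rpow.2 (show -p < -1 by linarith))
  simpa using this

theorem one_le_re_add {a : ℂ} (ha : 1 ≤ a.re) (n : ℕ) : 1 ≤ (a + n).re := by
  simp; linarith [(Nat.cast_nonneg n : (0 : ℝ) ≤ n)]

theorem add_natCast_ne_zero {a : ℂ} (ha : 1 ≤ a.re) (n : ℕ) : a + n ≠ 0 := fun h => by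
  have := one_le_re_add ha n
  rw [h] at this
  norm_num at this

theorem ne_zero_of_one_le_re {a : ℂ} (ha : 1 ≤ a.re) : a ≠ 0 := by
  simpa using add_natCast_ne_zero ha 0

theorem re_rpow_le {a : ℂ} (ha : 1 ≤ a.re) (n : ℕ) {p q : ℝ} (hp : 0 ≤ p) (hpq : p ≤ q) :
    (a + n).re ^ (-q) ≤ ((n : ℝ) + 1) ^ (-p) := by
  have hn : (0 : ℝ) ≤ n := Nat.cast_nonneg n
  refine (Real.rpow_le_rpow_of_exponent_le (one_le_re_add ha n) (neg_le_neg hpq)).trans ?_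
  refine Real.rpow_le_rpow_of_nonpos (by positivity) ?_ (by linarith)
  simp; linarith

theorem norm_cpow_neg_le_of_mem {a s : ℂ} {p R : ℝ} (ha : 1 ≤ a.re) (hp : 0 ≤ p)
    (hs : s ∈ boundedHalfPlane p R) (n : ℕ) :
    ‖(a + n) ^ (-s)‖ ≤ Real.exp (Real.pi * R) * ((n : ℝ) + 1) ^ (-p) := by
  have hs1 : p < s.re := hs.1
  have hs2 : ‖s‖ < R := by simpa using hs.2
  refine (norm_cpow_neg_le (one_le_re_add ha n) (by linarith)).trans ?_
  have h0 : 0 ≤ (a + n).re ^ (-s.re) :=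
    Real.rpow_nonneg (zero_le_one.trans (one_le_re_add ha n)) _
  gcongr
  · exact (Complex.abs_im_le_norm s).trans hs2.le
  · exact re_rpow_le ha n hp hs1.le

theorem norm_stepTerm_le {a s : ℂ} {R : ℝ} (ha : 1 ≤ a.re)
    (hs : s ∈ boundedHalfPlane (1 / 2) R) (n : ℕ) :
    ‖stepTerm a n s‖ ≤
      (R + 1) * (R * (Real.exp (Real.pi * R) * ((n : ℝ) + 1) ^ (-(3 / 2) : ℝ))) := by
  have hs1 : 1 / 2 < s.re := hs.1
  have hs2 : ‖s‖ < R := by simpa using hs.2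
  have hR : 0 ≤ R := (norm_nonneg s).trans hs2.le
  refine (norm_cpow_step_le (one_le_re_add ha n) (by linarith)).trans ?_
  have h0 : 0 ≤ (a + n).re ^ (-(s.re + 1)) :=
    Real.rpow_nonneg (zero_le_one.trans (one_le_re_add ha n)) _
  have h1 : (a + n).re ^ (-(s.re + 1)) ≤ ((n : ℝ) + 1) ^ (-(3 / 2) : ℝ) :=
    re_rpow_le ha n (by norm_num) (by linarith)
  gcongr
  · refine (norm_sub_le _ _).trans ?_
    rw [norm_one]
    linarith
  · exact (Complex.abs_im_le_norm s).trans hs2.le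

theorem differentiable_cpow_neg {x : ℂ} (hx : x ≠ 0) : Differentiable ℂ fun s : ℂ => x ^ (-s) :=
  fun _ => (differentiableAt_id.neg).const_cpow (Or.inl hx)

theorem differentiable_cpow_one_sub {x : ℂ} (hx : x ≠ 0) :
    Differentiable ℂ fun s : ℂ => x ^ (1 - s) :=
  fun _ => ((differentiableAt_const 1).sub differentiableAt_id).const_cpow (Or.inl hx)

theorem differentiable_stepTerm {a : ℂ} (ha : 1 ≤ a.re) (n : ℕ) :
    Differentiable ℂ (stepTerm a n) := by
  have h := differentiable_cpow_neg (add_natCast_ne_zero ha n)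
  have h1 := differentiable_cpow_one_sub (add_natCast_ne_zero ha n)
  have h2 := differentiable_cpow_one_sub (add_natCast_ne_zero ha (n + 1))
  push_cast at h2
  simp only [← add_assoc] at h2
  exact (((differentiable_id.sub_const 1).mul h).sub h1).add h2

theorem differentiableAt_poleFree {a s : ℂ} (ha : 1 ≤ a.re) (hs : 1 / 2 < s.re) :
    DifferentiableAt ℂ (poleFree a) s := by
  refine (differentiable_cpow_one_sub (ne_zero_of_one_le_re ha) s).add ?_
  have hU := isOpen_boundedHalfPlane (1 / 2) (‖s‖ + 1)
  refine (Complex.differentiableOn_tsum_of_summable_norm (F := fun n => stepTerm a n)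
    (((summable_add_one_rpow (show (1 : ℝ) < 3 / 2 by norm_num)).mul_left _).mul_left _ |>.mul_left _)
    (fun n => (differentiable_stepTerm ha n).differentiableOn) hU
    (fun n w hw => norm_stepTerm_le ha hw n)).differentiableAt
    (hU.mem_nhds (mem_boundedHalfPlane hs))

theorem hasSum_iteratedDeriv_stepTerm {a s : ℂ} (ha : 1 ≤ a.re) (hs : 1 / 2 < s.re) (r : ℕ) :
    HasSum (fun n => iteratedDeriv r (stepTerm a n) s)
      (iteratedDeriv r (fun w => ∑' n, stepTerm a n w) s) :=
  hasSum_iteratedDeriv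
    (((summable_add_one_rpow (show (1 : ℝ) < 3 / 2 by norm_num)).mul_left _).mul_left _ |>.mul_left _)
    (fun n => (differentiable_stepTerm ha n).differentiableOn) (isOpen_boundedHalfPlane _ _)
    (fun n w hw => norm_stepTerm_le ha hw n) (mem_boundedHalfPlane hs) r

theorem iteratedDeriv_cpow_neg {x : ℂ} (hx : x ≠ 0) (r : ℕ) (s : ℂ) :
    iteratedDeriv r (fun s : ℂ => x ^ (-s)) s = (-Complex.log x) ^ r * x ^ (-s) := by
  have : (fun s : ℂ => x ^ (-s)) = fun s => Complex.exp (-Complex.log x * s) := by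
    ext s; rw [Complex.cpow_def_of_ne_zero hx]; ring_nf
  rw [this, iteratedDeriv_cexp_const_mul, Complex.cpow_def_of_ne_zero hx]
  ring_nf

theorem iteratedDeriv_cpow_one_sub {x : ℂ} (hx : x ≠ 0) (r : ℕ) (s : ℂ) :
    iteratedDeriv r (fun s : ℂ => x ^ (1 - s)) s = (-Complex.log x) ^ r * x ^ (1 - s) := by
  have : (fun s : ℂ => x ^ (1 - s)) = fun s => x * x ^ (-s) := by
    ext s; rw [sub_eq_add_neg, Complex.cpow_add _ _ hx, Complex.cpow_one]
  rw [this, iteratedDeriv_const_mul_field, iteratedDeriv_cpow_neg hx, sub_eq_add_neg,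
    Complex.cpow_add _ _ hx, Complex.cpow_one]
  ring

/-- In the Leibniz formula at c only the first derivative of s - c survives. -/
theorem iteratedDeriv_sub_mul {g : ℂ → ℂ} {c : ℂ} {U : Set ℂ} (hU : U ∈ 𝓝 c)
    (hg : DifferentiableOn ℂ g U) (r : ℕ) :
    iteratedDeriv (r + 1) (fun s => (s - c) * g s) c = (r + 1) * iteratedDeriv r g c := by
  have hg' : ContDiffAt ℂ ((r + 1 : ℕ) : WithTop ℕ∞) g c :=
    (hg.analyticAt hU).contDiffAt
  rw [iteratedDeriv_fun_mul (by fun_prop) hg', sum_eq_single 1]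
  · rw [iteratedDeriv_one]
    simp
  · intro i _ hi
    rcases i with _ | _ | i
    · simp
    · simp at hi
    · have : iteratedDeriv (i + 1 + 1) (fun s : ℂ => s - c) c = 0 := by
        rw [iteratedDeriv_succ']
        have : deriv (fun s : ℂ => s - c) = fun _ => 1 := by ext; simp
        rw [this, iteratedDeriv_const]; simp
      rw [this]; ring
  · simp

theorem iteratedDeriv_stepTerm {a : ℂ} (ha : 1 ≤ a.re) (n r : ℕ) :
    iteratedDeriv (r + 1) (stepTerm a n) 1 =
      (r + 1) * ((-Complex.log (a + n)) ^ r / (a + n)) - (-Complex.log (a + n)) ^ (r + 1)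
        + (-Complex.log (a + n + 1)) ^ (r + 1) := by
  have hx := add_natCast_ne_zero ha n
  have hy : a + n + 1 ≠ 0 := by
    have := add_natCast_ne_zero ha (n + 1)
    push_cast at this
    rwa [← add_assoc] at this
  have h := differentiable_cpow_neg hx
  have h1 := differentiable_cpow_one_sub hx
  have h2 := differentiable_cpow_one_sub hy
  have hs : ContDiff ℂ ((r + 1 : ℕ) : WithTop ℕ∞) fun s : ℂ => (s - 1) * (a + n) ^ (-s) :=
    ((differentiable_id.sub_const 1).mul h).contDiff
  unfold stepTerm
  rw [iteratedDeriv_fun_add (hs.sub h1.contDiff).contDiffAt h2.contDiff.contDiffAt,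
    iteratedDeriv_fun_sub hs.contDiffAt h1.contDiff.contDiffAt,
    iteratedDeriv_sub_mul univ_mem h.differentiableOn, iteratedDeriv_cpow_neg hx,
    iteratedDeriv_cpow_one_sub hx, iteratedDeriv_cpow_one_sub hy, Complex.cpow_neg_one, sub_self,
    Complex.cpow_zero, Complex.cpow_zero]
  ring

theorem hasSum_cpow_neg_iteratedDeriv {a s : ℂ} (ha : 1 ≤ a.re) (hs : 1 < s.re) (r : ℕ) :
    HasSum (fun n : ℕ => (-Complex.log (a + n)) ^ r * (a + n) ^ (-s))
      (iteratedDeriv r (fun w => ∑' n : ℕ, (a + n) ^ (-w)) s) := by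
  have := hasSum_iteratedDeriv (F := fun n w => (a + n) ^ (-w))
    ((summable_add_one_rpow (show (1 : ℝ) < (1 + s.re) / 2 by linarith)).mul_left _)
    (fun n => (differentiable_cpow_neg (add_natCast_ne_zero ha n)).differentiableOn)
    (isOpen_boundedHalfPlane _ _)
    (fun n w hw => norm_cpow_neg_le_of_mem ha (by linarith) hw n)
    (mem_boundedHalfPlane (s := s) (by linarith)) r
  simpa only [iteratedDeriv_cpow_neg (add_natCast_ne_zero ha _)] using this

theorem tendsto_add_cpow_neg {a s : ℂ} (ha : 1 ≤ a.re) (hs : 0 < s.re) :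
    Tendsto (fun n : ℕ => (a + n) ^ (-s)) atTop (𝓝 0) := by
  have hb : Tendsto (fun n : ℕ => Real.exp (Real.pi * (‖s‖ + 1)) * ((n : ℝ) + 1) ^ (-(s.re / 2)))
      atTop (𝓝 0) := by
    rw [← mul_zero (Real.exp (Real.pi * (‖s‖ + 1)))]
    refine ((tendsto_rpow_neg_atTop (by linarith)).comp ?_).const_mul _
    exact tendsto_atTop_add_const_right _ _ tendsto_natCast_atTop_atTop
  exact squeeze_zero_norm (fun n => norm_cpow_neg_le_of_mem ha (by linarith)
    (mem_boundedHalfPlane (by linarith)) n) hb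

/-- The powers with exponent 1 - s telescope, and the boundary term (a+N)^(1-s) vanishes in the
limit. -/
theorem poleFree_eq_of_one_lt_re {a s : ℂ} (ha : 1 ≤ a.re) (hs : 1 < s.re) :
    poleFree a s = (s - 1) * ∑' n : ℕ, (a + n) ^ (-s) := by
  have h0 : HasSum (fun n : ℕ => (a + n) ^ (-s)) (∑' n : ℕ, (a + n) ^ (-s)) := by
    simpa using hasSum_cpow_neg_iteratedDeriv ha hs 0
  have h1 : HasSum (fun n => stepTerm a n s) (∑' n, stepTerm a n s) := by
    simpa using hasSum_iteratedDeriv_stepTerm ha (s := s) (by linarith) 0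
  have e : ∀ N : ℕ, ∑ n ∈ range N, stepTerm a n s =
      (s - 1) * ∑ n ∈ range N, (a + n) ^ (-s) + ((a + N) ^ (1 - s) - a ^ (1 - s)) := by
    intro N
    induction N with
    | zero => simp
    | succ N ih =>
      rw [sum_range_succ, ih, sum_range_succ, stepTerm]
      rw [Nat.cast_succ, ← add_assoc a]
      ring
  have h2 : Tendsto (fun N : ℕ => (a + N) ^ (1 - s)) atTop (𝓝 0) := by
    simpa using tendsto_add_cpow_neg ha (s := s - 1) (by simpa using hs)
  have h3 := (h0.tendsto_sum_nat.const_mul (s - 1)).add (h2.sub_const (a ^ (1 - s)))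
  simp only [← e] at h3
  rw [poleFree, tendsto_nhds_unique h1.tendsto_sum_nat h3]
  ring

theorem poleFree_one (a : ℂ) : poleFree a 1 = 1 := by
  simp [poleFree, stepTerm]

/-! ### Identification of the Hurwitz function and the Stieltjes constants -/

theorem isHurwitzContinuation_poleFree {a : ℂ} (ha : 1 ≤ a.re) :
    IsHurwitzContinuation a (1 / 2) fun s => poleFree a s / (s - 1) := by
  refine ⟨fun s hs => ?_, fun s hs => ?_⟩
  · have h1 : s - 1 ≠ 0 := sub_ne_zero.2 hs.2
    have h2 : DifferentiableAt ℂ (fun s : ℂ => s - 1) s := by fun_prop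
    exact ((differentiableAt_poleFree ha hs.1).div h2 h1).differentiableWithinAt
  · have : s - 1 ≠ 0 := sub_ne_zero.2 (by rintro rfl; simp at hs)
    simp only [poleFree_eq_of_one_lt_re ha hs]
    rw [mul_div_cancel_left₀ _ this]
    exact tsum_congr fun n => by rw [add_comm, Complex.cpow_neg, one_div]

/-- `hurwitz` evaluates an arbitrarily chosen continuation; the identity theorem makes the choice
irrelevant. -/
theorem IsHurwitzContinuation.eq {a s : ℂ} {r₁ r₂ : ℝ} {F₁ F₂ : ℂ → ℂ}
    (h₁ : IsHurwitzContinuation a r₁ F₁) (h₂ : IsHurwitzContinuation a r₂ F₂) (hs : s ≠ 1)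
    (hr₁ : r₁ < s.re) (hr₂ : r₂ < s.re) : F₁ s = F₂ s := by
  rcases lt_or_ge 1 s.re with hs1 | hs1
  · rw [h₁.2 s hs1, h₂.2 s hs1]
  -- A slanted line through 1 cuts out a convex region that avoids the pole and contains both s and
  -- 2 + 2ei, near which the Hurwitz series is valid. The sign e is chosen so that s lies on the
  -- right side.
  obtain ⟨e, he, hse⟩ : ∃ e : ℝ, (e = 1 ∨ e = -1) ∧ s.re - 1 < e * s.im := by
    rcases lt_or_ge s.im 0 with h | h
    · exact ⟨-1, Or.inr rfl, by linarith⟩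
    · refine ⟨1, Or.inl rfl, ?_⟩
      rcases hs1.lt_or_eq with h' | h'
      · linarith
      · have : s.im ≠ 0 := fun h0 => hs (Complex.ext (by simpa using h') (by simpa using h0))
        have := lt_of_le_of_ne h this.symm
        linarith
  set r := max r₁ r₂ with hr
  set U : Set ℂ := {z : ℂ | r < z.re} ∩ {z : ℂ | z.re - 1 < e * z.im} with hU
  have hUo : IsOpen U := (isOpen_lt continuous_const Complex.continuous_re).inter
    (isOpen_lt (by fun_prop) (by fun_prop))
  have hUc : Convex ℝ U := by
    refine (convex_halfSpace_re_gt r).inter ?_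
    have := convex_halfSpace_lt (𝕜 := ℝ) (f := fun z : ℂ => z.re - e * z.im)
      ⟨fun x y => by simp; ring, fun c x => by simp; ring⟩ 1
    convert! this using 1
    ext z
    simp only [Set.mem_ofPred_eq]
    constructor <;> intro h <;> linarith
  have hU1 : ∀ z ∈ U, z ≠ 1 := by
    rintro z hz rfl
    have := hz.2
    simp at this
  have a₁ : AnalyticOnNhd ℂ F₁ U := (h₁.1.mono fun z hz =>
    ⟨lt_of_le_of_lt (le_max_left r₁ r₂) hz.1, hU1 z hz⟩).analyticOnNhd hUo
  have a₂ : AnalyticOnNhd ℂ F₂ U := (h₂.1.mono fun z hz =>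
    ⟨lt_of_le_of_lt (le_max_right r₁ r₂) hz.1, hU1 z hz⟩).analyticOnNhd hUo
  have hz₀ : (⟨2, e * 2⟩ : ℂ) ∈ U := by
    have hre : r < s.re := max_lt hr₁ hr₂
    refine ⟨show r < 2 by linarith, show (2 : ℝ) - 1 < e * (e * 2) from ?_⟩
    rcases he with rfl | rfl <;> norm_num
  refine a₁.eqOn_of_preconnected_of_eventuallyEq a₂ hUc.isPreconnected hz₀ ?_
    ⟨max_lt hr₁ hr₂, hse⟩
  have : {z : ℂ | 1 < z.re} ∈ 𝓝 (⟨2, e * 2⟩ : ℂ) :=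
    (isOpen_lt continuous_const Complex.continuous_re).mem_nhds (show (1 : ℝ) < 2 by norm_num)
  filter_upwards [this] with z hz
  rw [h₁.2 z hz, h₂.2 z hz]

theorem hurwitz_eq {a s : ℂ} (ha : 1 ≤ a.re) (hs : 1 / 2 < s.re) (hs1 : s ≠ 1) :
    hurwitz s a = poleFree a s / (s - 1) := by
  have hF := isHurwitzContinuation_poleFree ha
  have h : s ≠ 1 ∧ ∃ F : ℂ → ℂ, ∃ r : ℝ, r < s.re ∧ IsHurwitzContinuation a r F :=
    ⟨hs1, _, _, hs, hF⟩
  rw [hurwitz, dif_pos h]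
  obtain ⟨r, hr, hF'⟩ := h.2.choose_spec
  exact hF'.eq hF hs1 hr hs

theorem hasSum_hurwitzDeriv {a s : ℂ} (ha : 1 ≤ a.re) (hs : 1 < s.re) (r : ℕ) :
    HasSum (fun n : ℕ => (-Complex.log (a + n)) ^ r * (a + n) ^ (-s)) (hurwitzDeriv r s a) := by
  convert! hasSum_cpow_neg_iteratedDeriv ha hs r using 1
  refine Filter.EventuallyEq.iteratedDeriv_eq r ?_
  filter_upwards [(isOpen_lt continuous_const Complex.continuous_re).mem_nhds hs] with z hz
  have hz1 : z ≠ 1 := by rintro rfl; simp at hz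
  have hz' : 1 < z.re := hz
  rw [hurwitz_eq ha (by linarith) hz1, poleFree_eq_of_one_lt_re ha hz,
    mul_div_cancel_left₀ _ (sub_ne_zero.2 hz1)]

/-- Since (s-1)ζ(s,a) equals 1 at s = 1, subtracting the pole leaves a difference quotient. -/
theorem hurwitzRegular_eventuallyEq {a : ℂ} (ha : 1 ≤ a.re) :
    hurwitzRegular a =ᶠ[𝓝 1] dslope (poleFree a) 1 := by
  have hmem : {z : ℂ | 1 / 2 < z.re} ∈ 𝓝 (1 : ℂ) :=
    (isOpen_lt continuous_const Complex.continuous_re).mem_nhds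
      (show (1 : ℝ) / 2 < (1 : ℂ).re by norm_num)
  have key : ∀ z : ℂ, 1 / 2 < z.re → z ≠ 1 →
      hurwitz z a - 1 / (z - 1) = slope (poleFree a) 1 z := by
    intro z hz hz1
    rw [hurwitz_eq ha hz hz1, slope_def_field, poleFree_one, sub_div]
  have hlim : Tendsto (fun σ : ℂ => hurwitz σ a - 1 / (σ - 1)) (𝓝[≠] (1 : ℂ))
      (𝓝 (deriv (poleFree a) 1)) := by
    have := hasDerivAt_iff_tendsto_slope.1
      (differentiableAt_poleFree ha (s := 1) (by norm_num)).hasDerivAt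
    refine this.congr' ?_
    filter_upwards [nhdsWithin_le_nhds hmem, self_mem_nhdsWithin] with z hz hz1
    exact (key z hz hz1).symm
  filter_upwards [hmem] with z hz
  rcases eq_or_ne z 1 with rfl | hz1
  · rw [hurwitzRegular, Function.update_self, hlim.limUnder_eq, dslope_same]
  · rw [hurwitzRegular, Function.update_of_ne hz1, dslope_of_ne _ hz1, key z hz hz1]

theorem iteratedDeriv_dslope {f : ℂ → ℂ} {c : ℂ} {U : Set ℂ} (hU : U ∈ 𝓝 c)
    (hf : DifferentiableOn ℂ f U) (r : ℕ) :
    (r + 1) * iteratedDeriv r (dslope f c) c = iteratedDeriv (r + 1) f c := by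
  rw [← iteratedDeriv_sub_mul hU ((Complex.differentiableOn_dslope hU).2 hf)]
  have : f = fun s => f c + (s - c) * dslope f c s := by
    ext s
    have := sub_smul_dslope f c s
    rw [smul_eq_mul] at this
    rw [this]; ring
  conv_rhs => rw [this]
  rw [iteratedDeriv_const_add (Nat.succ_pos r)]

/-- Both sides are the (r+1)-st derivative at 1 of the step series, which is `poleFree a` minus
a^(1-s). Up to telescoping, this is the classical limit formula for γ_r(a). -/
theorem hasSum_stieltjes {a : ℂ} (ha : 1 ≤ a.re) (r : ℕ) :
    HasSum (fun n : ℕ => (r + 1) * ((-Complex.log (a + n)) ^ r / (a + n))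
        - (-Complex.log (a + n)) ^ (r + 1) + (-Complex.log (a + n + 1)) ^ (r + 1))
      ((r + 1) * ((-1) ^ r * stieltjes r a) - (-Complex.log a) ^ (r + 1)) := by
  have h := hasSum_iteratedDeriv_stepTerm ha (s := 1) (by norm_num) (r + 1)
  simp only [iteratedDeriv_stepTerm ha] at h
  convert! h using 1
  have hU : {z : ℂ | 1 / 2 < z.re} ∈ 𝓝 (1 : ℂ) :=
    (isOpen_lt continuous_const Complex.continuous_re).mem_nhds
      (show (1 : ℝ) / 2 < (1 : ℂ).re by norm_num)
  have e : (-1 : ℂ) ^ r * (-1) ^ r = 1 := by rw [← mul_pow]; norm_num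
  have hd : DifferentiableOn ℂ (fun w => ∑' n, stepTerm a n w) {z : ℂ | 1 / 2 < z.re} := by
    have : (fun w => ∑' n, stepTerm a n w) = fun w => poleFree a w - a ^ (1 - w) := by
      ext w; rw [poleFree]; ring
    rw [this]
    exact fun z hz => ((differentiableAt_poleFree ha hz).sub
      (differentiable_cpow_one_sub (ne_zero_of_one_le_re ha) z)).differentiableWithinAt
  rw [stieltjes, ← mul_assoc ((-1 : ℂ) ^ r), e, one_mul,
    (hurwitzRegular_eventuallyEq ha).iteratedDeriv_eq,
    iteratedDeriv_dslope hU fun z hz => (differentiableAt_poleFree ha hz).differentiableWithinAt]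
  unfold poleFree
  rw [iteratedDeriv_fun_add
    (differentiable_cpow_one_sub (ne_zero_of_one_le_re ha)).contDiff.contDiffAt
    (hd.analyticAt hU).contDiffAt, iteratedDeriv_cpow_one_sub (ne_zero_of_one_le_re ha)]
  simp

/-! ### Taylor series of log^(ℓ+1)/(ℓ+1) -/

/-- `j!` times the `j`-th Taylor coefficient of `log ^ (ℓ + 1) / (ℓ + 1)` at `x`, for `j ≥ 1`. -/
noncomputable def logPowCoeff (ℓ : ℕ) (x : ℂ) (j : ℕ) : ℂ :=
  ∑ k ∈ range (ℓ + 1),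
    stirling j (k + 1) * ((ℓ ! : ℂ) / ((ℓ - k)! : ℂ)) * Complex.log x ^ (ℓ - k) * (x ^ j)⁻¹

/-- The antiderivative of `log x ^ ℓ / x`. -/
noncomputable def logPow (ℓ : ℕ) (x : ℂ) : ℂ := Complex.log x ^ (ℓ + 1) / ((ℓ : ℂ) + 1)

theorem stirling_succ_succ (n k : ℕ) :
    stirling (n + 1) (k + 1) = stirling n k - n * stirling n (k + 1) := by
  simp only [stirling, Nat.stirlingFirst_succ_succ]
  push_cast
  ring

theorem stirling_succ_zero (n : ℕ) : stirling (n + 1) 0 = 0 := by simp [stirling]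

theorem stirlingFirst_le_factorial (n k : ℕ) : Nat.stirlingFirst n k ≤ n ! := by
  induction n generalizing k with
  | zero => cases k <;> simp
  | succ n ih =>
    cases k with
    | zero => simp
    | succ k =>
      rw [Nat.stirlingFirst_succ_succ, Nat.factorial_succ, add_mul, one_mul]
      exact add_le_add (Nat.mul_le_mul_left _ (ih _)) (ih _)

theorem norm_stirling_le (n k : ℕ) : ‖stirling n k‖ ≤ n ! := by
  simp only [stirling, norm_mul, norm_pow, norm_neg, norm_one, one_pow, one_mul, Complex.norm_natCast]
  exact_mod_cast stirlingFirst_le_factorial n k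

theorem logPowCoeff_one (ℓ : ℕ) (x : ℂ) : logPowCoeff ℓ x 1 = Complex.log x ^ ℓ / x := by
  rw [logPowCoeff, sum_eq_single 0]
  · simp [stirling, Nat.stirlingFirst_self, div_eq_mul_inv, Nat.factorial_ne_zero]
  · intro k _ hk
    rw [stirling, Nat.stirlingFirst_eq_zero_of_lt (by omega)]
    simp
  · simp

theorem hasDerivAt_logPow {x : ℂ} (hx : x ∈ Complex.slitPlane) (ℓ : ℕ) :
    HasDerivAt (logPow ℓ) (logPowCoeff ℓ x 1) x := by
  have h := ((Complex.hasDerivAt_log hx).pow (ℓ + 1)).div_const ((ℓ : ℂ) + 1)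
  refine h.congr_deriv ?_
  have : (ℓ : ℂ) + 1 ≠ 0 := Nat.cast_add_one_ne_zero ℓ
  rw [logPowCoeff_one]
  push_cast
  field_simp

/-- Differentiating the logarithm shifts k by one, differentiating the power multiplies by -(j+1);
together they reproduce the Stirling recurrence. -/
theorem hasDerivAt_logPowCoeff {x : ℂ} (hx : x ∈ Complex.slitPlane) (ℓ j : ℕ) :
    HasDerivAt (fun z => logPowCoeff ℓ z (j + 1)) (logPowCoeff ℓ x (j + 2)) x := by
  have hx0 : x ≠ 0 := Complex.slitPlane_ne_zero hx
  have h : ∀ k ∈ range (ℓ + 1), HasDerivAt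
      (fun z => stirling (j + 1) (k + 1) * ((ℓ ! : ℂ) / ((ℓ - k)! : ℂ)) *
        Complex.log z ^ (ℓ - k) * (z ^ (j + 1))⁻¹)
      (stirling (j + 1) (k + 1) * ((ℓ ! : ℂ) / ((ℓ - k)! : ℂ)) *
          ((ℓ - k : ℕ) * Complex.log x ^ (ℓ - k - 1)) * (x ^ (j + 2))⁻¹ -
        (j + 1) * (stirling (j + 1) (k + 1) * ((ℓ ! : ℂ) / ((ℓ - k)! : ℂ)) *
          Complex.log x ^ (ℓ - k) * (x ^ (j + 2))⁻¹)) x := by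
    intro k _
    refine ((((Complex.hasDerivAt_log hx).pow (ℓ - k)).const_mul _).mul
      ((hasDerivAt_pow (j + 1) x).inv (pow_ne_zero _ hx0))).congr_deriv ?_
    simp only [add_tsub_cancel_right, Pi.pow_apply, Pi.inv_apply]
    push_cast
    field_simp
    ring
  have e : ∀ k ∈ range ℓ, stirling (j + 1) (k + 1) * ((ℓ ! : ℂ) / ((ℓ - k)! : ℂ)) *
      ((ℓ - k : ℕ) * Complex.log x ^ (ℓ - k - 1)) * (x ^ (j + 2))⁻¹ =
      stirling (j + 1) (k + 1) * ((ℓ ! : ℂ) / ((ℓ - (k + 1))! : ℂ)) *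
        Complex.log x ^ (ℓ - (k + 1)) * (x ^ (j + 2))⁻¹ := by
    intro k hk
    obtain ⟨p, rfl⟩ : ∃ p, ℓ = k + (p + 1) := ⟨ℓ - k - 1, by have := mem_range.1 hk; omega⟩
    have h1 : k + (p + 1) - k = p + 1 := by omega
    have h2 : k + (p + 1) - (k + 1) = p := by omega
    rw [h1, h2, Nat.factorial_succ p, add_tsub_cancel_right]
    have : ((p : ℂ) + 1) ≠ 0 := Nat.cast_add_one_ne_zero p
    push_cast
    field_simp
  refine (HasDerivAt.fun_sum h).congr_deriv ?_
  rw [sum_sub_distrib, sum_range_succ, sum_congr rfl e, logPowCoeff]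
  simp only [stirling_succ_succ (j + 1), sub_mul, sum_sub_distrib]
  -- The shifted sum lacks a k = 0 term, which is harmless as s(j+1, 0) = 0.
  rw [sum_range_succ' (fun k => stirling (j + 1) k * _ * _ * _), stirling_succ_zero]
  simp [mul_assoc]

theorem iteratedDeriv_logPow (ℓ j : ℕ) {x : ℂ} (hx : x ∈ Complex.slitPlane) :
    iteratedDeriv (j + 1) (logPow ℓ) x = logPowCoeff ℓ x (j + 1) := by
  induction j generalizing x with
  | zero => rw [zero_add, iteratedDeriv_one]; exact (hasDerivAt_logPow hx ℓ).deriv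
  | succ j ih =>
    rw [iteratedDeriv_succ, ← (hasDerivAt_logPowCoeff hx ℓ j).deriv]
    refine Filter.EventuallyEq.deriv_eq ?_
    filter_upwards [Complex.isOpen_slitPlane.mem_nhds hx] with z hz using ih hz

/-- When Re x ≥ 0, the point of the cut (-∞, 0] nearest to x is 0. -/
theorem ball_subset_slitPlane {x : ℂ} (hx : 0 ≤ x.re) :
    Metric.ball x ‖x‖ ⊆ Complex.slitPlane := by
  intro z hz
  by_contra h
  rw [Complex.mem_slitPlane_iff, not_or, not_lt, not_not] at h
  rw [mem_ball_iff_norm, ← sq_lt_sq₀ (norm_nonneg _) (norm_nonneg _), Complex.sq_norm,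
    Complex.sq_norm, Complex.normSq_apply, Complex.normSq_apply] at hz
  simp only [Complex.sub_re, Complex.sub_im, h.2] at hz
  nlinarith [mul_nonneg hx (neg_nonneg.2 h.1)]

theorem hasSum_logPowCoeff {x e : ℂ} (hx : 0 ≤ x.re) (he : ‖e‖ < ‖x‖) (ℓ : ℕ) :
    HasSum (fun j : ℕ => e ^ (j + 1) / ((j + 1)! : ℂ) * logPowCoeff ℓ x (j + 1))
      (logPow ℓ (x + e) - logPow ℓ x) := by
  have hd : DifferentiableOn ℂ (logPow ℓ) (Metric.ball x ‖x‖) := fun z hz =>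
    (hasDerivAt_logPow (ball_subset_slitPlane hx hz) ℓ).differentiableAt.differentiableWithinAt
  have h := Complex.hasSum_taylorSeries_on_ball hd (z := x + e) (by simpa using he)
  have h' := (hasSum_nat_add_iff' 1).2 h
  have hxs : x ∈ Complex.slitPlane := ball_subset_slitPlane hx
    (Metric.mem_ball_self ((norm_nonneg e).trans_lt he))
  simp only [iteratedDeriv_logPow ℓ _ hxs] at h'
  convert! h' using 1
  · ext j
    simp only [add_sub_cancel_left, smul_eq_mul]
    rw [div_eq_inv_mul, mul_assoc]
  · simp

/-! ### The coefficients c_j as sums over shifts, and the exchange of sums -/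

theorem hasSum_coeffZ {a : ℂ} (ha : 1 ≤ a.re) (ℓ : ℕ) {j : ℕ} (hj : 2 ≤ j) :
    HasSum (fun n : ℕ => (-1) ^ ℓ * logPowCoeff ℓ (a + n) j) (coeffZ ℓ a j) := by
  have hj1 : 1 < ((j : ℂ)).re := by rw [Complex.natCast_re]; exact_mod_cast hj
  have := hasSum_sum (s := range (ℓ + 1)) fun k _ => (hasSum_hurwitzDeriv ha hj1 (ℓ - k)).mul_left
    (stirling j (k + 1) * ((ℓ ! : ℂ) / ((ℓ - k)! : ℂ)) * (-1) ^ k)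
  convert! this using 1
  ext n
  rw [logPowCoeff, mul_sum]
  refine sum_congr rfl fun k hk => ?_
  have hk' : k ≤ ℓ := by have := mem_range.1 hk; omega
  rw [Complex.cpow_neg, Complex.cpow_natCast, neg_pow (Complex.log (a + n))]
  conv_lhs => rw [← Nat.add_sub_of_le hk', pow_add]
  rw [Nat.add_sub_of_le hk']
  ring

/-- Splitting off n = 0 moves the remaining double series to Re ≥ 2, where it converges absolutely.
-/
theorem coeffZ_eq_add {a : ℂ} (ha : 1 ≤ a.re) (ℓ : ℕ) {j : ℕ} (hj : 2 ≤ j) :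
    coeffZ ℓ a j = (-1) ^ ℓ * logPowCoeff ℓ a j + coeffZ ℓ (a + 1) j := by
  have h := (hasSum_nat_add_iff' 1).2 (hasSum_coeffZ ha ℓ hj)
  have h' := hasSum_coeffZ (a := a + 1) (by simp; linarith) ℓ hj
  have : (fun n : ℕ => (-1) ^ ℓ * logPowCoeff ℓ (a + (n + 1 : ℕ)) j) =
      fun n : ℕ => (-1) ^ ℓ * logPowCoeff ℓ (a + 1 + n) j := by
    ext n; push_cast; rw [add_right_comm, add_assoc]
  rw [this] at h
  rw [h'.unique h]
  simp

theorem summable_log_pow_mul {a : ℂ} (ha : 1 ≤ a.re) (r : ℕ) :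
    Summable fun n : ℕ => ‖Complex.log (a + n)‖ ^ r * (‖a + n‖ ^ 2)⁻¹ := by
  have := (hasSum_cpow_neg_iteratedDeriv ha (s := 2) (by norm_num) r).summable.norm
  refine this.congr fun n => ?_
  rw [Complex.cpow_neg, norm_mul, norm_pow, norm_neg, norm_inv]
  rw [show (2 : ℂ) = (2 : ℕ) by norm_num, Complex.cpow_natCast, norm_pow]

theorem tendsto_log_pow_div {a : ℂ} (ha : 1 ≤ a.re) (r : ℕ) :
    Tendsto (fun n : ℕ => Complex.log (a + n) ^ r / (a + n)) atTop (𝓝 0) := by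
  -- The squared norms are the terms of a convergent series.
  have h := (summable_log_pow_mul ha (2 * r)).tendsto_atTop_zero
  rw [tendsto_zero_iff_norm_tendsto_zero]
  have h2 := h.sqrt
  rw [Real.sqrt_zero] at h2
  refine h2.congr fun n => ?_
  rw [norm_div, norm_pow, mul_comm 2, pow_mul, ← div_eq_mul_inv, ← div_pow,
    Real.sqrt_sq (by positivity)]

/-- The sum of the terms of degree at least two of the Taylor series of `logPow` at `x`. -/
noncomputable def logPowTail (ℓ : ℕ) (e x : ℂ) : ℂ :=
  logPow ℓ (x + e) - logPow ℓ x - e * (Complex.log x ^ ℓ / x)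

theorem hasSum_logPowTail {x e : ℂ} (hx : 0 ≤ x.re) (he : ‖e‖ < ‖x‖) (ℓ : ℕ) :
    HasSum (fun j : ℕ => e ^ (j + 2) / ((j + 2)! : ℂ) * logPowCoeff ℓ x (j + 2))
      (logPowTail ℓ e x) := by
  have := (hasSum_nat_add_iff' 1).2 (hasSum_logPowCoeff hx he ℓ)
  simpa [logPowTail, logPowCoeff_one] using this

theorem norm_logPowCoeff_div_le (ℓ : ℕ) (x : ℂ) (j : ℕ) :
    ‖logPowCoeff ℓ x j / (j ! : ℂ)‖ ≤
      ∑ k ∈ range (ℓ + 1), (ℓ ! : ℝ) / ((ℓ - k)! : ℝ) * ‖Complex.log x‖ ^ (ℓ - k) * (‖x‖ ^ j)⁻¹ := by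
  rw [logPowCoeff, sum_div]
  refine (norm_sum_le _ _).trans (sum_le_sum fun k _ => ?_)
  simp only [norm_mul, norm_div, norm_pow, norm_inv, Complex.norm_natCast]
  have hj : (0 : ℝ) < j ! := by exact_mod_cast Nat.factorial_pos j
  rw [div_le_iff₀ hj]
  have := norm_stirling_le j (k + 1)
  calc _ = ‖stirling j (k + 1)‖ *
        ((ℓ ! : ℝ) / ((ℓ - k)! : ℝ) * ‖Complex.log x‖ ^ (ℓ - k) * (‖x‖ ^ j)⁻¹) := by ring
    _ ≤ (j ! : ℝ) * ((ℓ ! : ℝ) / ((ℓ - k)! : ℝ) * ‖Complex.log x‖ ^ (ℓ - k) * (‖x‖ ^ j)⁻¹) := by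
      gcongr
    _ = _ := by ring

/-- Stirling numbers are at most j! in modulus and |a+n| ≥ 2, so the terms are dominated by a
product of 2^(-j) and a summable sequence of log powers over |a+n|^2. -/
theorem summable_logPowCoeff_prod {a e : ℂ} (ha : 2 ≤ a.re) (he : ‖e‖ ≤ 1) (ℓ : ℕ) :
    Summable fun p : ℕ × ℕ =>
      e ^ (p.2 + 2) / ((p.2 + 2)! : ℂ) * logPowCoeff ℓ (a + p.1) (p.2 + 2) := by
  have h1 : Summable fun n : ℕ => ∑ k ∈ range (ℓ + 1),
      (ℓ ! : ℝ) / ((ℓ - k)! : ℝ) * (‖Complex.log (a + n)‖ ^ (ℓ - k) * (‖a + n‖ ^ 2)⁻¹) :=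
    summable_sum fun k _ => (summable_log_pow_mul (by linarith) _).mul_left _
  have h2 : Summable fun j : ℕ => ((1 : ℝ) / 2) ^ j := summable_geometric_two
  refine Summable.of_norm_bounded (h1.mul_of_nonneg h2 (fun n => ?_) fun j => ?_) fun p => ?_
  · exact sum_nonneg fun k _ => by positivity
  · positivity
  · have hx : 2 ≤ ‖a + p.1‖ := by
      refine le_trans ?_ (Complex.re_le_norm _)
      simp; linarith [(Nat.cast_nonneg p.1 : (0 : ℝ) ≤ p.1)]
    rw [div_mul_eq_mul_div, mul_div_assoc, norm_mul, norm_pow]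
    refine (mul_le_of_le_one_left (norm_nonneg _) (pow_le_one₀ (norm_nonneg _) he)).trans ?_
    refine (norm_logPowCoeff_div_le _ _ _).trans ?_
    rw [sum_mul]
    refine sum_le_sum fun k _ => ?_
    have : (‖a + p.1‖ ^ (p.2 + 2))⁻¹ ≤ (‖a + p.1‖ ^ 2)⁻¹ * (1 / 2) ^ p.2 := by
      rw [pow_add, mul_inv, mul_comm, one_div, inv_pow]
      gcongr
    calc _ ≤ (ℓ ! : ℝ) / ((ℓ - k)! : ℝ) * ‖Complex.log (a + p.1)‖ ^ (ℓ - k) *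
          ((‖a + p.1‖ ^ 2)⁻¹ * (1 / 2) ^ p.2) := by gcongr
      _ = _ := by ring

theorem exists_hasSum_swap {f : ℕ → ℕ → ℂ} {g h : ℕ → ℂ}
    (hf : Summable fun p : ℕ × ℕ => f p.1 p.2) (hg : ∀ n, HasSum (f n) (g n))
    (hh : ∀ j, HasSum (fun n => f n j) (h j)) : ∃ D, HasSum g D ∧ HasSum h D := by
  obtain ⟨D, hD⟩ := hf
  exact ⟨D, hD.prod_fiberwise hg, ((Equiv.prodComm ℕ ℕ).hasSum_iff.2 hD).prod_fiberwise hh⟩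

theorem hasSum_coeffZ_of_two_le_re {a e : ℂ} (ha : 2 ≤ a.re) (he : ‖e‖ ≤ 1) (ℓ : ℕ) :
    ∃ D : ℂ, HasSum (fun n : ℕ => logPowTail ℓ e (a + n)) D ∧
      HasSum (fun j : ℕ => e ^ (j + 2) / ((j + 2)! : ℂ) * coeffZ ℓ a (j + 2))
        ((-1) ^ ℓ * D) := by
  have hre : ∀ n : ℕ, 2 ≤ (a + n).re := fun n => by
    rw [Complex.add_re, Complex.natCast_re]
    linarith [(Nat.cast_nonneg n : (0 : ℝ) ≤ n)]
  have hn : ∀ n : ℕ, ‖e‖ < ‖a + n‖ := fun n => by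
    linarith [hre n, Complex.re_le_norm (a + n)]
  have hsq : (-1 : ℂ) ^ ℓ * (-1) ^ ℓ = 1 := by rw [← mul_pow]; norm_num
  have hj : ∀ j : ℕ, HasSum
      (fun n : ℕ => e ^ (j + 2) / ((j + 2)! : ℂ) * logPowCoeff ℓ (a + n) (j + 2))
      ((-1) ^ ℓ * (e ^ (j + 2) / ((j + 2)! : ℂ) * coeffZ ℓ a (j + 2))) := by
    intro j
    have h := ((hasSum_coeffZ (one_le_two.trans ha) ℓ (Nat.le_add_left 2 j)).mul_left
      ((-1) ^ ℓ)).mul_left (e ^ (j + 2) / ((j + 2)! : ℂ))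
    simp only [← mul_assoc ((-1 : ℂ) ^ ℓ), hsq, one_mul] at h
    rw [mul_left_comm]
    exact h
  obtain ⟨D, hD, hD'⟩ := exists_hasSum_swap (f := fun n j : ℕ =>
      e ^ (j + 2) / ((j + 2)! : ℂ) * logPowCoeff ℓ (a + n) (j + 2))
    (summable_logPowCoeff_prod ha he ℓ)
    (fun n => hasSum_logPowTail (zero_le_two.trans (hre n)) (hn n) ℓ) hj
  refine ⟨D, hD, ?_⟩
  have h := hD'.mul_left ((-1) ^ ℓ)
  simp only [← mul_assoc ((-1 : ℂ) ^ ℓ) ((-1) ^ ℓ), hsq, one_mul] at h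
  exact h

/-! ### Decay of Stirling numbers and the boundary case a = 1 -/

/-- The unsigned Stirling number of the first kind divided by a factorial. -/
noncomputable def stirlingRatio (m j : ℕ) : ℝ := (Nat.stirlingFirst j m : ℝ) / j !

theorem stirlingRatio_nonneg (m j : ℕ) : 0 ≤ stirlingRatio m j := by
  unfold stirlingRatio; positivity

theorem stirlingRatio_succ (m j : ℕ) :
    ((j : ℝ) + 1) * stirlingRatio (m + 1) (j + 1) =
      j * stirlingRatio (m + 1) j + stirlingRatio m j := by
  have hj : (j ! : ℝ) ≠ 0 := by exact_mod_cast Nat.factorial_ne_zero j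
  have hj1 : (j : ℝ) + 1 ≠ 0 := Nat.cast_add_one_ne_zero j
  simp only [stirlingRatio, Nat.stirlingFirst_succ_succ, Nat.factorial_succ]
  push_cast
  field_simp

/-- By the recurrence, j times the ratio for m+1 is a partial sum of the ratios for m, and a sum of
terms O(i^(-1/2)) is O(j^(1/2)). The exponent 1/2 avoids tracking the logarithms in the true order.
-/
theorem exists_stirlingRatio_mul_sqrt_le (m : ℕ) :
    ∃ C : ℝ, ∀ j : ℕ, stirlingRatio m j * √((j : ℝ) + 1) ≤ C := by
  induction m with
  | zero =>
    refine ⟨1, fun j => ?_⟩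
    cases j <;> simp [stirlingRatio]
  | succ m ih =>
    obtain ⟨C, hC⟩ := ih
    have hC0 : 0 ≤ C := (mul_nonneg (stirlingRatio_nonneg m 0) (Real.sqrt_nonneg _)).trans (hC 0)
    have key : ∀ j : ℕ, j * stirlingRatio (m + 1) j ≤ 2 * C * √(j : ℝ) := by
      intro j
      induction j with
      | zero => simp
      | succ j ihj =>
        push_cast
        rw [stirlingRatio_succ]
        have hp : 0 < √((j : ℝ) + 1) := Real.sqrt_pos.2 (by positivity)
        have h1 : √(j : ℝ) ^ 2 = j := Real.sq_sqrt (by positivity)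
        have h2 : √((j : ℝ) + 1) ^ 2 = j + 1 := Real.sq_sqrt (by positivity)
        have h3 : stirlingRatio m j ≤ C / √((j : ℝ) + 1) := (le_div_iff₀ hp).2 (hC j)
        -- Discrete form of integrating t^(-1/2); it closes the induction with constant 2C.
        have h4 : 2 * √(j : ℝ) + 1 / √((j : ℝ) + 1) ≤ 2 * √((j : ℝ) + 1) := by
          rw [← le_sub_iff_add_le', div_le_iff₀ hp]
          nlinarith [sq_nonneg (√((j : ℝ) + 1) - √(j : ℝ))]
        calc _ ≤ 2 * C * √(j : ℝ) + C / √((j : ℝ) + 1) := add_le_add ihj h3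
          _ = C * (2 * √(j : ℝ) + 1 / √((j : ℝ) + 1)) := by ring
          _ ≤ C * (2 * √((j : ℝ) + 1)) := by gcongr
          _ = _ := by ring
    refine ⟨4 * C, fun j => ?_⟩
    rcases Nat.eq_zero_or_pos j with rfl | hj
    · simpa [stirlingRatio] using hC0
    · have hj' : (1 : ℝ) ≤ j := by exact_mod_cast hj
      have h1 : √(j : ℝ) ^ 2 = j := Real.sq_sqrt (by positivity)
      have hp : 0 < √(j : ℝ) := Real.sqrt_pos.2 (by positivity)
      have h2 : √((j : ℝ) + 1) ≤ 2 * √(j : ℝ) := by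
        rw [Real.sqrt_le_iff]
        exact ⟨by positivity, by nlinarith⟩
      have h3 : √(j : ℝ) * stirlingRatio (m + 1) j ≤ 2 * C := by
        have := key j
        nth_rewrite 1 [← h1] at this
        exact le_of_mul_le_mul_right (by linarith) hp
      have := mul_le_mul_of_nonneg_left h2 (stirlingRatio_nonneg (m + 1) j)
      linarith

theorem tendsto_stirlingRatio (m : ℕ) : Tendsto (stirlingRatio m) atTop (𝓝 0) := by
  obtain ⟨C, hC⟩ := exists_stirlingRatio_mul_sqrt_le m
  have h : Tendsto (fun j : ℕ => C / √((j : ℝ) + 1)) atTop (𝓝 0) := by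
    refine Tendsto.const_div_atTop ?_ C
    exact Real.tendsto_sqrt_atTop.comp
      (tendsto_atTop_add_const_right _ _ tendsto_natCast_atTop_atTop)
  refine squeeze_zero (stirlingRatio_nonneg m) (fun j => ?_) h
  exact (le_div_iff₀ (Real.sqrt_pos.2 (by positivity))).2 (hC j)

/-- The recurrence gives (j+1) times the difference as the ratio for m+1 minus that for m, both at
j, so the difference is O(j^(-3/2)). Bounded variation replaces monotonicity in the alternating
test. -/
theorem summable_stirlingRatio_sub (m : ℕ) :
    Summable fun j => stirlingRatio (m + 1) j - stirlingRatio (m + 1) (j + 1) := by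
  obtain ⟨C, hC⟩ := exists_stirlingRatio_mul_sqrt_le m
  obtain ⟨C', hC'⟩ := exists_stirlingRatio_mul_sqrt_le (m + 1)
  have hs : Summable fun j : ℕ => ((j : ℝ) + 1) ^ (-(3 / 2) : ℝ) := by
    have := (summable_nat_add_iff 1).2
      (Real.summable_nat_rpow.2 (show (-(3 / 2) : ℝ) < -1 by norm_num))
    simpa using this
  refine Summable.of_norm_bounded (hs.mul_left (C + C')) fun j => ?_
  have hj : (0 : ℝ) < j + 1 := by positivity
  have hp : 0 < √((j : ℝ) + 1) := Real.sqrt_pos.2 hj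
  have e : ((j : ℝ) + 1) ^ (-(3 / 2) : ℝ) = 1 / (((j : ℝ) + 1) * √((j : ℝ) + 1)) := by
    rw [Real.sqrt_eq_rpow, one_div, ← Real.rpow_one_add' hj.le (by norm_num), ← Real.rpow_neg hj.le]
    norm_num
  have h1 : (((j : ℝ) + 1) * √((j : ℝ) + 1)) *
      (stirlingRatio (m + 1) j - stirlingRatio (m + 1) (j + 1)) =
      stirlingRatio (m + 1) j * √((j : ℝ) + 1) - stirlingRatio m j * √((j : ℝ) + 1) := by
    linear_combination (-√((j : ℝ) + 1)) * stirlingRatio_succ m j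
  rw [e, mul_one_div, le_div_iff₀ (by positivity), Real.norm_eq_abs, mul_comm]
  nth_rewrite 1 [← abs_of_pos (mul_pos hj hp)]
  rw [← abs_mul, h1]
  have := mul_nonneg (stirlingRatio_nonneg m j) hp.le
  have := mul_nonneg (stirlingRatio_nonneg (m + 1) j) hp.le
  rw [abs_le]
  constructor <;> linarith [hC j, hC' j]

theorem exists_tendsto_alternating {u : ℕ → ℝ} (hu : Tendsto u atTop (𝓝 0))
    (hs : Summable fun j => u j - u (j + 1)) :
    ∃ l : ℝ, Tendsto (fun N => ∑ j ∈ range N, (-1) ^ j * u j) atTop (𝓝 l) := by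
  have hs' : Summable fun j => (-1) ^ j * (u j - u (j + 1)) :=
    Summable.of_norm_bounded hs.norm fun j => by simp
  have hb : Tendsto (fun N => (-1) ^ N * u N) atTop (𝓝 0) :=
    squeeze_zero_norm (a := fun N => |u N|) (fun N => by simp) (by simpa using hu.abs)
  -- Summation by parts: twice the N-th partial sum is ∑_{j<N} (-1)^j (u_j - u_{j+1}) + u_0 - (-1)^N
  -- u_N.
  refine ⟨((∑' j, (-1) ^ j * (u j - u (j + 1))) + u 0 - 0) / 2, ?_⟩
  refine (((hs'.hasSum.tendsto_sum_nat.add_const (u 0)).sub hb).div_const 2).congr fun N => ?_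
  induction N with
  | zero => simp
  | succ N ih =>
    rw [sum_range_succ _ N, sum_range_succ _ N, ← ih]
    ring

theorem sum_Icc_succ_eq_sum_range (g : ℕ → ℂ) (b N : ℕ) :
    ∑ j ∈ Icc (b + 1) (N + b), g j = ∑ j ∈ range N, g (j + (b + 1)) := by
  induction N with
  | zero => simp
  | succ N ih =>
    rw [sum_range_succ, ← ih, show N + 1 + b = N + b + 1 by omega,
      sum_Icc_succ_top (by omega), add_assoc N b 1]

theorem tendsto_sum_Icc_succ {g : ℕ → ℂ} {b : ℕ} {S : ℂ}
    (h : Tendsto (fun N => ∑ j ∈ range N, g (j + (b + 1))) atTop (𝓝 S)) :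
    Tendsto (fun m => ∑ j ∈ Icc (b + 1) m, g j) atTop (𝓝 S) := by
  rw [← tendsto_add_atTop_iff_nat b]
  simpa only [sum_Icc_succ_eq_sum_range] using h

theorem logPowCoeff_at_one (ℓ j : ℕ) :
    logPowCoeff ℓ 1 j = stirling j (ℓ + 1) * (ℓ ! : ℂ) := by
  rw [logPowCoeff, sum_range_succ, sum_eq_zero]
  · simp
  · intro k hk
    have : ℓ - k ≠ 0 := by have := mem_range.1 hk; omega
    simp [this]

theorem exists_tendsto_logPowCoeff_at_one (ℓ : ℕ) :
    ∃ l : ℂ, Tendsto (fun N => ∑ j ∈ range N, logPowCoeff ℓ 1 j / (j ! : ℂ)) atTop (𝓝 l) := by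
  obtain ⟨l, hl⟩ := exists_tendsto_alternating (tendsto_stirlingRatio (ℓ + 1))
    (summable_stirlingRatio_sub ℓ)
  refine ⟨_, (((Complex.continuous_ofReal.tendsto l).comp hl).const_mul
    ((-1) ^ (ℓ + 1) * (ℓ ! : ℂ))).congr fun N => ?_⟩
  simp only [Function.comp_apply, Complex.ofReal_sum, mul_sum]
  refine sum_congr rfl fun j _ => ?_
  rw [logPowCoeff_at_one, stirling, stirlingRatio]
  push_cast
  ring

/-- The point 2 lies on the circle of convergence of the Taylor series at 1. The series converges
there, so Abel's theorem identifies its sum with the radial limit of L(1+t). -/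
theorem tendsto_logPowCoeff_at_one (ℓ : ℕ) :
    Tendsto (fun N => ∑ j ∈ range N, logPowCoeff ℓ 1 j / (j ! : ℂ)) atTop (𝓝 (logPow ℓ (1 + 1))) := by
  obtain ⟨l, hl⟩ := exists_tendsto_logPowCoeff_at_one ℓ
  have h0 : logPow ℓ 1 = 0 := by simp [logPow]
  have hc0 : logPowCoeff ℓ 1 0 = 0 := by
    rw [logPowCoeff_at_one]
    simp [stirling]
  have h1 := Complex.tendsto_tsum_powerSeries_nhdsWithin_lt hl
  rw [tendsto_map'_iff] at h1
  have h2 : Tendsto (fun t : ℝ => logPow ℓ (1 + t)) (𝓝[<] 1) (𝓝 (logPow ℓ (1 + 1))) := by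
    have hm : (1 + (1 : ℝ) : ℂ) ∈ Complex.slitPlane := by
      left; norm_num
    have hc : ContinuousAt (fun t : ℝ => logPow ℓ (1 + t)) 1 :=
      ContinuousAt.comp (f := fun t : ℝ => (1 + t : ℂ)) (hasDerivAt_logPow hm ℓ).continuousAt
        (by fun_prop)
    have := hc.tendsto
    simp only [Complex.ofReal_one] at this
    exact this.mono_left nhdsWithin_le_nhds
  have h3 : (fun t : ℝ => logPow ℓ (1 + t)) =ᶠ[𝓝[<] 1]
      (fun z : ℂ => ∑' j, logPowCoeff ℓ 1 j / (j ! : ℂ) * z ^ j) ∘ Complex.ofReal := by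
    filter_upwards [Ioo_mem_nhdsLT (show (0 : ℝ) < 1 by norm_num)] with t ht
    have hs := hasSum_logPowCoeff (x := 1) (e := (t : ℂ)) (by norm_num)
      (by simpa [abs_of_pos ht.1] using ht.2) ℓ
    rw [h0, sub_zero] at hs
    have hs' : HasSum (fun j : ℕ => logPowCoeff ℓ 1 j / (j ! : ℂ) * (t : ℂ) ^ j)
        (logPow ℓ (1 + t)) := by
      rw [← hasSum_nat_add_iff' 1]
      simp only [sum_range_one, hc0, zero_div, zero_mul, sub_zero]
      convert! hs using 2 with j
      ring
    exact hs'.tsum_eq.symm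
  rw [tendsto_nhds_unique (h2.congr' h3) h1]
  exact hl

/-! ### Summing the Taylor tails and telescoping -/

theorem one_lt_norm {a : ℂ} (ha : 1 ≤ a.re) (ha1 : a ≠ 1) : 1 < ‖a‖ := by
  by_contra! h
  have hre : a.re = 1 := le_antisymm ((Complex.re_le_norm a).trans h) ha
  have h1 : ‖a‖ ^ 2 ≤ 1 := pow_le_one₀ (norm_nonneg _) h
  rw [Complex.sq_norm, Complex.normSq_apply, hre] at h1
  exact ha1 (Complex.ext hre (by simp; nlinarith [mul_self_nonneg a.im]))

theorem tendsto_logPowTail {a e : ℂ} (ha : 1 ≤ a.re) (he : ‖e‖ ≤ 1) (h1 : a ≠ 1 ∨ e = 1) (ℓ : ℕ) :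
    Tendsto (fun N => ∑ j ∈ range N, e ^ (j + 2) / ((j + 2)! : ℂ) * logPowCoeff ℓ a (j + 2))
      atTop (𝓝 (logPowTail ℓ e a)) := by
  rcases eq_or_ne a 1 with rfl | ha1
  · obtain rfl : e = 1 := h1.resolve_left (fun h => h rfl)
    have h := ((tendsto_add_atTop_iff_nat 2).2 (tendsto_logPowCoeff_at_one ℓ)).sub_const
      (Complex.log 1 ^ ℓ / 1)
    have hc0 : logPowCoeff ℓ 1 0 = 0 := by
      rw [logPowCoeff_at_one]
      simp [stirling]
    convert! h using 2 with N
    · rw [sum_range_succ', sum_range_succ', ← logPowCoeff_one, hc0]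
      simp [div_eq_inv_mul]
    · have h0 : logPow ℓ 1 = 0 := by simp [logPow]
      rw [logPowTail, h0]
      ring
  · exact (hasSum_logPowTail (by linarith) (he.trans_lt (one_lt_norm ha ha1)) ℓ).tendsto_sum_nat

/-- Only the n = 0 tail can fail to converge absolutely in j. The hypothesis `h1` excludes, in
particular, a = 1 with e = -1, where the expansion would reach the singularity of the logarithm at
0. -/
theorem tendsto_coeffZ {a e : ℂ} (ha : 1 ≤ a.re) (he : ‖e‖ ≤ 1) (h1 : a ≠ 1 ∨ e = 1) (ℓ : ℕ) :
    ∃ D : ℂ, HasSum (fun n : ℕ => logPowTail ℓ e (a + n)) D ∧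
      Tendsto (fun m => ∑ j ∈ Icc 2 m, e ^ j / (j ! : ℂ) * coeffZ ℓ a j)
        atTop (𝓝 ((-1) ^ ℓ * D)) := by
  obtain ⟨D, hD, hD'⟩ := hasSum_coeffZ_of_two_le_re (a := a + 1) (by simp; linarith) he ℓ
  refine ⟨D + logPowTail ℓ e a, ?_, ?_⟩
  · rw [← hasSum_nat_add_iff' 1]
    convert! hD using 1
    · ext n; push_cast; congr 1; ring
    · simp
  · refine tendsto_sum_Icc_succ (b := 1) ?_
    have h := ((tendsto_logPowTail ha he h1 ℓ).const_mul ((-1) ^ ℓ)).add hD'.tendsto_sum_nat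
    rw [← mul_add, add_comm (logPowTail ℓ e a)] at h
    refine h.congr fun N => ?_
    rw [mul_sum, ← sum_add_distrib]
    refine sum_congr rfl fun j _ => ?_
    rw [coeffZ_eq_add ha ℓ (Nat.le_add_left 2 j)]
    ring

theorem stieltjes_eq {a D : ℂ} (ha : 1 ≤ a.re) (ℓ : ℕ)
    (hD : HasSum (fun n : ℕ => logPowTail ℓ 1 (a + n)) D) :
    (-1) ^ ℓ * stieltjes ℓ a = -((-1) ^ ℓ * logPow ℓ a) - (-1) ^ ℓ * D := by
  have hl : (ℓ : ℂ) + 1 ≠ 0 := Nat.cast_add_one_ne_zero ℓ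
  have h := hasSum_stieltjes ha ℓ
  -- With this factor the tails become the summands of `hasSum_stieltjes`.
  have h' := hD.mul_left (-(-1) ^ ℓ * ((ℓ : ℂ) + 1))
  have e : (fun n : ℕ => -(-1) ^ ℓ * ((ℓ : ℂ) + 1) * logPowTail ℓ 1 (a + n)) = fun n : ℕ =>
      (ℓ + 1) * ((-Complex.log (a + n)) ^ ℓ / (a + n))
        - (-Complex.log (a + n)) ^ (ℓ + 1) + (-Complex.log (a + n + 1)) ^ (ℓ + 1) := by
    ext n
    simp only [logPowTail, logPow]
    rw [neg_pow (Complex.log (a + n)) ℓ, neg_pow (Complex.log (a + n)) (ℓ + 1),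
      neg_pow (Complex.log (a + n + 1))]
    field_simp
    ring
  rw [e] at h'
  have key := h.unique h'
  rw [neg_pow (Complex.log a)] at key
  have hL : ((ℓ : ℂ) + 1) * logPow ℓ a = Complex.log a ^ (ℓ + 1) := mul_div_cancel₀ _ hl
  apply mul_left_cancel₀ hl
  linear_combination key + (-1) ^ ℓ * hL

theorem logPowTail_sum_add_sum {a D : ℂ} (ha : 1 ≤ a.re) (ℓ : ℕ)
    (hD : HasSum (fun n : ℕ => logPowTail ℓ 1 (a + n)) D) {D' : ℂ}
    (hD' : HasSum (fun n : ℕ => logPowTail ℓ (-1) (a + n)) D') :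
    D + D' = logPow ℓ (a - 1) - logPow ℓ a := by
  have hs := (hD.add hD').tendsto_sum_nat
  -- The linear terms cancel, leaving second differences of L. The bracket is the boundary term
  -- L(a+N) - L(a+N-1), written so that each part visibly tends to 0.
  have e : ∀ N : ℕ, ∑ n ∈ range N, (logPowTail ℓ 1 (a + n) + logPowTail ℓ (-1) (a + n)) =
      logPow ℓ (a - 1) - logPow ℓ a + (Complex.log (a + N) ^ ℓ / (a + N)
        - logPowTail ℓ (-1) (a + N)) := by
    intro N
    induction N with
    | zero =>
      simp only [logPowTail]
      simp
      ring_nf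
    | succ N ih =>
      rw [sum_range_succ, ih]
      have h1 : a + (N + 1 : ℕ) + -1 = a + N := by push_cast; ring
      have h2 : a + (N + 1 : ℕ) = a + N + 1 := by push_cast; ring
      simp only [logPowTail]
      rw [h1, h2]
      ring
  simp only [e] at hs
  have h0 := ((tendsto_log_pow_div ha ℓ).sub hD'.summable.tendsto_atTop_zero).const_add
    (logPow ℓ (a - 1) - logPow ℓ a)
  rw [sub_zero, add_zero] at h0
  exact tendsto_nhds_unique hs h0

theorem exists_tendsto_stirling {a : ℂ} (ha : 1 < ‖a‖) (ℓ : ℕ) :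
    ∃ T : ℕ → ℂ, ∀ k, Tendsto (fun m : ℕ => ∑ j ∈ Icc 1 m,
      (-1) ^ (j + ℓ + 1) * a ^ (-(j : ℤ)) / (j ! : ℂ) * stirling j (k + 1)) atTop (𝓝 (T k)) := by
  refine ⟨fun k => ∑' j : ℕ, (-1) ^ (j + 1 + ℓ + 1) * a ^ (-((j + 1 : ℕ) : ℤ)) /
    ((j + 1)! : ℂ) * stirling (j + 1) (k + 1), fun k => tendsto_sum_Icc_succ (b := 0) ?_⟩
  refine (Summable.hasSum ?_).tendsto_sum_nat
  have hg : Summable fun j : ℕ => ‖a‖⁻¹ ^ (j + 1) :=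
    (summable_nat_add_iff 1).2 (summable_geometric_of_lt_one (by positivity) (inv_lt_one_of_one_lt₀ ha))
  refine Summable.of_norm_bounded hg fun j => ?_
  have hj : (0 : ℝ) < (j + 1)! := by exact_mod_cast Nat.factorial_pos (j + 1)
  have := norm_stirling_le (j + 1) (k + 1)
  rw [zpow_neg, zpow_natCast]
  simp only [norm_mul, norm_div, norm_pow, norm_neg, norm_one, one_pow, one_mul, norm_inv,
    Complex.norm_natCast]
  rw [div_mul_eq_mul_div, div_le_iff₀ hj, inv_pow]
  gcongr

/-- Collecting the finite sum over k inside the series over j gives the Taylor series of L at a with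
increment -1. -/
theorem sum_mul_eq_logPow_sub {a : ℂ} (ha : 0 ≤ a.re) (ha1 : 1 < ‖a‖) (ℓ : ℕ) {T : ℕ → ℂ}
    (hT : ∀ k ≤ ℓ, Tendsto (fun m : ℕ => ∑ j ∈ Icc 1 m,
      (-1) ^ (j + ℓ + 1) * a ^ (-(j : ℤ)) / (j ! : ℂ) * stirling j (k + 1)) atTop (𝓝 (T k))) :
    ∑ k ∈ range (ℓ + 1), (ℓ ! : ℂ) / ((ℓ - k)! : ℂ) * Complex.log a ^ (ℓ - k) * T k =
      (-1) ^ (ℓ + 1) * (logPow ℓ (a - 1) - logPow ℓ a) := by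
  have h1 := tendsto_finsetSum (range (ℓ + 1)) fun k hk =>
    (hT k (Nat.lt_succ_iff.1 (mem_range.1 hk))).const_mul
      ((ℓ ! : ℂ) / ((ℓ - k)! : ℂ) * Complex.log a ^ (ℓ - k))
  have h2 := ((hasSum_logPowCoeff ha (e := -1) (by simpa using ha1) ℓ).mul_left
    ((-1) ^ (ℓ + 1))).tendsto_sum_nat
  have h3 := tendsto_sum_Icc_succ (b := 0) (g := fun j =>
    (-1) ^ (ℓ + 1) * ((-1) ^ j / (j ! : ℂ) * logPowCoeff ℓ a j)) h2
  rw [← sub_eq_add_neg] at h3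
  refine tendsto_nhds_unique h1 (h3.congr fun m => ?_)
  simp only [mul_sum]
  rw [sum_comm]
  refine sum_congr rfl fun j _ => ?_
  rw [logPowCoeff, mul_sum, mul_sum]
  refine sum_congr rfl fun k _ => ?_
  rw [zpow_neg, zpow_natCast, add_assoc j ℓ 1, pow_add (-1 : ℂ) j]
  ring

end GenStieltjes

theorem mainTheorem3 (ℓ : ℕ) (a : ℂ) (ha : 1 ≤ a.re) :
    (a ≠ 1 →
      (∃ (S : ℂ) (T : ℕ → ℂ),
        Tendsto (fun m : ℕ => ∑ j ∈ Icc 2 m, (-1) ^ j / (j ! : ℂ) * GenStieltjes.coeffZ ℓ a j)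
          atTop (𝓝 S) ∧
        (∀ k ≤ ℓ, Tendsto (fun m : ℕ => ∑ j ∈ Icc 1 m,
            (-1) ^ (j + ℓ + 1) * a ^ (-(j : ℤ)) / (j ! : ℂ) * GenStieltjes.stirling j (k + 1))
          atTop (𝓝 (T k))) ∧
        (-1) ^ ℓ * GenStieltjes.stieltjes ℓ a =
          S + ∑ k ∈ range (ℓ + 1),
              (ℓ ! : ℂ) / ((ℓ - k)! : ℂ) * Complex.log a ^ (ℓ - k) * T k
            + Complex.log a ^ (ℓ + 1) / ((ℓ : ℂ) + 1) * (-1) ^ (ℓ + 1)) ∧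
      (∃ S : ℂ,
        Tendsto (fun m : ℕ => ∑ j ∈ Icc 2 m, (-1) ^ j / (j ! : ℂ) * GenStieltjes.coeffZ ℓ a j)
          atTop (𝓝 S) ∧
        (-1) ^ ℓ * GenStieltjes.stieltjes ℓ a =
          -((-1) ^ ℓ * Complex.log (a - 1) ^ (ℓ + 1) / ((ℓ : ℂ) + 1)) + S)) ∧
    (∃ S : ℂ,
      Tendsto (fun n : ℕ => ∑ j ∈ Icc 2 n, 1 / (j ! : ℂ) * GenStieltjes.coeffZ ℓ a j)
        atTop (𝓝 S) ∧
      (-1) ^ ℓ * GenStieltjes.stieltjes ℓ a =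
        -((-1) ^ ℓ * Complex.log a ^ (ℓ + 1) / ((ℓ : ℂ) + 1)) - S) := by
  obtain ⟨D, hD, hS⟩ := GenStieltjes.tendsto_coeffZ (e := 1) ha (by simp) (Or.inr rfl) ℓ
  have hγ := GenStieltjes.stieltjes_eq ha ℓ hD
  simp only [one_pow] at hS
  refine ⟨fun ha1 => ?_, _, hS, ?_⟩
  · obtain ⟨D', hD', hS'⟩ := GenStieltjes.tendsto_coeffZ (e := -1) ha (by simp) (Or.inl ha1) ℓ
    have hDD := GenStieltjes.logPowTail_sum_add_sum ha ℓ hD hD'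
    have h2 : (-1) ^ ℓ * GenStieltjes.stieltjes ℓ a =
        -((-1) ^ ℓ * GenStieltjes.logPow ℓ (a - 1)) + (-1) ^ ℓ * D' := by
      rw [hγ]
      linear_combination (-(-1) ^ ℓ) * hDD
    have hn := GenStieltjes.one_lt_norm ha ha1
    obtain ⟨T, hT⟩ := GenStieltjes.exists_tendsto_stirling hn ℓ
    refine ⟨⟨_, T, hS', fun k _ => hT k, ?_⟩, _, hS', ?_⟩
    · rw [GenStieltjes.sum_mul_eq_logPow_sub (zero_le_one.trans ha) hn ℓ fun k _ => hT k, h2,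
        ← GenStieltjes.logPow]
      ring
    · rw [h2, GenStieltjes.logPow, mul_div_assoc]
  · rw [hγ, GenStieltjes.logPow, mul_div_assoc]
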